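/- Let $\mathbb{H}=\{z\in\mathbb{C}:\operatorname{Im} z>0\}$ with hyperbolic distance $\rho_{\mathbb{H}}$, and let $\phi:\mathbb{H}\to\mathbb{H}$ be an analytic map of the form $\phi(z)=Az+p(z)$ with $A\ge 1$, $\operatorname{Im} p(z)>0$ for all $z\in\mathbb{H}$, and $p(z)/z\to 0$ as $z\to\infty$ non-tangentially, that is, within each sector $\{|\operatorname{Arg} z-\pi/2|<\theta\}$, $0<\theta<\pi/2$. Write $\phi_n$ for the $n$-th iterate of $\phi$. The map $\phi$ is called hyperbolic if $A>1$ and parabolic if $A=1$; a parabolic $\phi$ is called zero-step if $\lim_{n\to\infty}\rho_{\mathbb{H}}(\phi_n(z),\phi_{n+1}(z))=0$ for all $z\in\mathbb{H}$, and non-zero-step if this limit is positive for all $z\in\mathbb{H}$. Let $\mathcal{F}(\phi)$ be the set of all pairs $(\sigma,\tau)$ where $\sigma:\mathbb{H}\to\mathbb{H}$ is analytic and non-constant, $\tau$ is an (analytic) automorphism of $\mathbb{H}$, and $\sigma\circ\phi=\tau\circ\sigma$. (1) Suppose $\phi$ is hyperbolic or parabolic non-zero-step. Let $z_0\in\mathbb{H}$,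 write $\phi_n(z_0)=x_n+iy_n$, and let $\gamma_n(z)=(z-x_n)/y_n$. Then $\gamma_n\circ\phi_n$ converges locally uniformly on $\mathbb{H}$ to a map $g:\mathbb{H}\to\mathbb{H}$, $\gamma_n\circ\gamma_{n+1}^{-1}$ converges locally uniformly on $\mathbb{H}$ to an automorphism $\alpha(z)=cz+b$ with $c>0$ and $b\in\mathbb{R}$, and $(g,\alpha)\in\mathcal{F}(\phi)$. Moreover $g$ is hyperbolically maximal: for every $(\sigma,\tau)\in\mathcal{F}(\phi)$, $$\rho_{\mathbb{H}}(\sigma(z),\sigma(w))\le\rho_{\mathbb{H}}(g(z),g(w))\qquad\text{for all } z,w\in\mathbb{H}.$$ (2) If $\phi$ is parabolic zero-step, then $\mathcal{F}(\phi)$ is empty. -/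

import Mathlib

open Filter Topology UpperHalfPlane
open scoped Manifold

namespace HalfPlaneDynamics

/-- `f` is an analytic self-map of the upper half-plane: it is complex differentiable
as a `ℂ`-valued function on `ℍ`. -/
def IsAnalyticSelfMap (f : ℍ → ℍ) : Prop :=
  MDifferentiable 𝓘(ℂ) 𝓘(ℂ) (fun z : ℍ => (f z : ℂ))

/-- `τ ∈ Aut(ℍ)`: an analytic self-map with an analytic two-sided inverse. -/
def IsAut (τ : ℍ → ℍ) : Prop :=
  IsAnalyticSelfMap τ ∧
    ∃ η : ℍ → ℍ, IsAnalyticSelfMap η ∧ Function.LeftInverse η τ ∧ Function.RightInverse η τ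

/-- The Stolz angle `{z ∈ ℍ : |Arg z - π / 2| < θ}` at infinity. -/
def stolzAngle (θ : ℝ) : Set ℍ :=
  {z : ℍ | |Complex.arg (z : ℂ) - Real.pi / 2| < θ}

/-- The non-tangential limit of `f` at `∞` is `l`: in every Stolz angle, `f z → l` as
`|z| → ∞`. -/
def NTLimAtInfty (f : ℍ → ℂ) (l : ℂ) : Prop :=
  ∀ θ : ℝ, 0 < θ → θ < Real.pi / 2 →
    Tendsto f (comap (fun z : ℍ => ‖(z : ℂ)‖) atTop ⊓ 𝓟 (stolzAngle θ)) (𝓝 l)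

/-- `φ` is a self-map of `ℍ` of the form `φ z = A z + p z` with `A ≥ 1`, `Im p > 0` and
`n.t.-lim_{z → ∞} p z / z = 0`; here `p z = φ z - A z`. It is hyperbolic if `A > 1` and
parabolic if `A = 1`. -/
structure IsNormalForm (φ : ℍ → ℍ) (A : ℝ) : Prop where
  analytic : IsAnalyticSelfMap φ
  one_le : 1 ≤ A
  im_pos : ∀ z : ℍ, 0 < ((φ z : ℂ) - (A : ℂ) * (z : ℂ)).im
  ntLim : NTLimAtInfty (fun z : ℍ => ((φ z : ℂ) - (A : ℂ) * (z : ℂ)) / (z : ℂ)) 0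

/-- The hyperbolic steps `ρ_ℍ(φ_n z, φ_{n+1} z)` of the forward orbit of `z` tend to `s`. -/
def HasLimitStep (φ : ℍ → ℍ) (z : ℍ) (s : ℝ) : Prop :=
  Tendsto (fun n : ℕ => dist (φ^[n] z) (φ^[n + 1] z)) atTop (𝓝 s)

/-- The limit step vanishes at every point. -/
def ZeroStep (φ : ℍ → ℍ) : Prop :=
  ∀ z : ℍ, HasLimitStep φ z 0

/-- The limit step is positive at every point. -/
def NonZeroStep (φ : ℍ → ℍ) : Prop :=
  ∀ z : ℍ, ∃ s : ℝ, 0 < s ∧ HasLimitStep φ z s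

/-- The family of all pairs `(σ, τ)` with `σ` a non-constant analytic self-map of `ℍ`,
`τ ∈ Aut(ℍ)` and `σ ∘ φ = τ ∘ σ`. -/
def forwardSolutions (φ : ℍ → ℍ) : Set ((ℍ → ℍ) × (ℍ → ℍ)) :=
  {q | IsAnalyticSelfMap q.1 ∧ (∃ z w : ℍ, q.1 z ≠ q.1 w) ∧ IsAut q.2 ∧
    q.1 ∘ φ = q.2 ∘ q.1}

/-- For `c > 0` and `b` real, the automorphism `z ↦ c z + b` of `ℍ`, which fixes `∞`. -/
def affineMap (c : ℝ) (hc : 0 < c) (b : ℝ) : ℍ → ℍ := fun z =>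
  ⟨(c : ℂ) * (z : ℂ) + (b : ℂ), by
    simpa using mul_pos hc z.im_pos⟩

/-- `z ↦ (z - Re w) / Im w`, the element of `Aut_∞(ℍ)` that sends `w` to `i`. -/
noncomputable def renorm (w : ℍ) : ℍ → ℍ :=
  affineMap (w.im)⁻¹ (inv_pos.mpr w.im_pos) (-(w.re / w.im))

/-- `z ↦ (Im w) z + Re w`, the inverse of `renorm w`. -/
noncomputable def renormInv (w : ℍ) : ℍ → ℍ :=
  affineMap w.im w.im_pos w.re

theorem coe_renorm (w z : ℍ) : (renorm w z : ℂ) = ((z : ℂ) - (w.re : ℂ)) / (w.im : ℂ) := by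
  simp only [renorm, affineMap]
  push_cast
  ring

theorem renorm_self (w : ℍ) : renorm w w = UpperHalfPlane.I := by
  apply UpperHalfPlane.ext
  rw [coe_renorm, coe_I, div_eq_iff (by exact_mod_cast w.im_ne_zero)]
  linear_combination -w.re_add_im

theorem renormInv_renorm (w z : ℍ) : renormInv w (renorm w z) = z := by
  apply UpperHalfPlane.ext
  have h : (w.im : ℂ) ≠ 0 := by exact_mod_cast w.im_ne_zero
  have h2 : (renormInv w (renorm w z) : ℂ) = (w.im : ℂ) * (renorm w z : ℂ) + (w.re : ℂ) := rfl
  rw [h2, coe_renorm]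
  field_simp
  ring

theorem renorm_renormInv (w z : ℍ) : renorm w (renormInv w z) = z := by
  apply UpperHalfPlane.ext
  have h : (w.im : ℂ) ≠ 0 := by exact_mod_cast w.im_ne_zero
  have h2 : (renormInv w z : ℂ) = (w.im : ℂ) * (z : ℂ) + (w.re : ℂ) := rfl
  rw [coe_renorm, h2]
  field_simp
  ring

/-- `(g, α)` is the pair obtained by renormalizing the iterates of `φ` along the orbit
`z_n = φ_n z₀`: with `γ_n = renorm z_n`, the maps `γ_n ∘ φ_n` tend to `g` and the maps
`γ_n ∘ γ_{n+1}⁻¹` tend to `α ∈ Aut_∞(ℍ)`, both locally uniformly on `ℍ`. -/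
structure IsRenormalizationPair (φ : ℍ → ℍ) (z₀ : ℍ) (g α : ℍ → ℍ) : Prop where
  tendsto_g :
    TendstoLocallyUniformly (fun (n : ℕ) (z : ℍ) => renorm (φ^[n] z₀) (φ^[n] z)) g atTop
  tendsto_α :
    TendstoLocallyUniformly
      (fun (n : ℕ) (z : ℍ) => renorm (φ^[n] z₀) (renormInv (φ^[n + 1] z₀) z)) α atTop
  affine : ∃ (c : ℝ) (hc : 0 < c) (b : ℝ), α = affineMap c hc b

end HalfPlaneDynamics

namespace HalfPlaneDynamics

open Set ComplexConjugate

/-! By Schwarz–Pick the distances between two orbits decrease to a limit `orbitDist φ z w`. If `σ ∘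
φ = τ ∘ σ`, then `τ` is an isometry, so `σ` has the same distance at all times and `dist (σ z) (σ w)
≤ orbitDist φ z w` (`dist_forwardSolution_le`). Renormalizations are isometries too, so every limit
point `g` of the renormalized iterates attains equality (`dist_renorm_limit`); this is maximality.

Limit points exist by compactness. Any two of them have the same distance to `I`, so their Cayley
transforms differ by a constant factor. When the step stays positive, both maps send the orbit of
`z₀` to `∞`, where the Cayley transform tends to `1`; the factor is therefore `1` and the whole
sequence converges (`exists_tendsto_renorm`).

In the zero-step case it suffices that `orbitDist` vanishes (`orbitDist_eq_zero`). Otherwise a limit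
point `g` would be non-constant and `φ`-invariant, and being nearly injective at the renormalized
scale it would force `φ` to have a fixed point. -/

theorem tanh_strictMono : StrictMono Real.tanh := by
  intro x y h
  rw [Real.tanh_eq_sinh_div_cosh, Real.tanh_eq_sinh_div_cosh,
    div_lt_div_iff₀ (Real.cosh_pos x) (Real.cosh_pos y)]
  have h1 : Real.sinh (x - y) < 0 := Real.sinh_neg_iff.2 (by linarith)
  rw [Real.sinh_sub] at h1
  linarith

/-! ### Cayley transform and Schwarz–Pick -/

/-- The Cayley transform of `ℍ` onto the unit disc which sends `w` to `0`. -/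
noncomputable def cayley (w : ℍ) (z : ℂ) : ℂ := (z - w) / (z - conj (w : ℂ))

theorem sub_conj_ne_zero (w : ℍ) {z : ℂ} (hz : 0 < z.im) : z - conj (w : ℂ) ≠ 0 := by
  intro h
  have h1 := congrArg Complex.im h
  have h2 := w.im_pos
  simp at h1
  linarith

theorem norm_cayley (w z : ℍ) : ‖cayley w z‖ = Real.tanh (dist z w / 2) := by
  rw [tanh_half_dist, cayley, norm_div, dist_eq_norm, dist_eq_norm]

theorem norm_cayley_lt_one (w z : ℍ) : ‖cayley w z‖ < 1 := by
  rw [norm_cayley]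
  exact Real.tanh_lt_one _

theorem cayley_self (w : ℍ) : cayley w w = 0 := by simp [cayley]

theorem differentiableOn_cayley (w : ℍ) : DifferentiableOn ℂ (cayley w) {z | 0 < z.im} := by
  intro z hz
  have h1 : DifferentiableAt ℂ (fun z : ℂ => z - w) z := by fun_prop
  have h2 : DifferentiableAt ℂ (fun z : ℂ => z - conj (w : ℂ)) z := by fun_prop
  exact (h1.div h2 (sub_conj_ne_zero w hz)).differentiableWithinAt

theorem cayley_injOn (w : ℍ) : InjOn (cayley w) {z | 0 < z.im} := by
  intro z hz z' hz' h
  rw [cayley, cayley, div_eq_div_iff (sub_conj_ne_zero w hz) (sub_conj_ne_zero w hz')] at h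
  have h1 : ((w : ℂ) - conj (w : ℂ)) * (z - z') = 0 := by linear_combination h
  rcases mul_eq_zero.1 h1 with h2 | h2
  · exact absurd h2 (sub_conj_ne_zero w w.im_pos)
  · exact sub_eq_zero.1 h2

/-- The inverse of the Cayley transform `cayley w`. -/
noncomputable def cayleyInv (w : ℍ) (ζ : ℂ) : ℂ := (w - conj (w : ℂ) * ζ) / (1 - ζ)

theorem one_sub_ne_zero {ζ : ℂ} (hζ : ‖ζ‖ < 1) : 1 - ζ ≠ 0 := by
  intro h
  rw [← sub_eq_zero.1 h] at hζ
  simp at hζ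

theorem im_cayleyInv (w : ℍ) {ζ : ℂ} (hζ : ‖ζ‖ < 1) : 0 < (cayleyInv w ζ).im := by
  have h1 : 0 < Complex.normSq (1 - ζ) := Complex.normSq_pos.2 (one_sub_ne_zero hζ)
  have h2 : (cayleyInv w ζ).im = w.im * (1 - ‖ζ‖ ^ 2) / Complex.normSq (1 - ζ) := by
    rw [cayleyInv, Complex.div_im, ← Complex.normSq_eq_norm_sq, Complex.normSq_apply ζ]
    simp
    ring
  rw [h2]
  have h3 : ‖ζ‖ ^ 2 < 1 := by nlinarith [norm_nonneg ζ]
  exact div_pos (mul_pos w.im_pos (by linarith)) h1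

theorem cayleyInv_cayley (w z : ℍ) : cayleyInv w (cayley w z) = z := by
  have h1 := sub_conj_ne_zero w z.im_pos
  have h2 := sub_conj_ne_zero w w.im_pos
  have h3 : 1 - ((z : ℂ) - w) / ((z : ℂ) - conj (w : ℂ))
      = ((w : ℂ) - conj (w : ℂ)) / ((z : ℂ) - conj (w : ℂ)) := by
    field_simp
    ring
  rw [cayleyInv, cayley, h3]
  field_simp
  ring

theorem differentiableOn_cayleyInv (w : ℍ) :
    DifferentiableOn ℂ (cayleyInv w) (Metric.ball 0 1) := by
  intro ζ hζ
  refine (DifferentiableAt.div ?_ ?_ (one_sub_ne_zero (by simpa using hζ))).differentiableWithinAt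
  all_goals fun_prop

theorem isAnalyticSelfMap_iff {f : ℍ → ℍ} :
    IsAnalyticSelfMap f ↔
      DifferentiableOn ℂ (fun z : ℂ => (f (ofComplex z) : ℂ)) {z | 0 < z.im} :=
  mdifferentiable_iff

/-- The **Schwarz–Pick lemma** for the upper half-plane. -/
theorem IsAnalyticSelfMap.dist_le {f : ℍ → ℍ} (hf : IsAnalyticSelfMap f) (z w : ℍ) :
    dist (f z) (f w) ≤ dist z w := by
  have h0 : cayleyInv w 0 = w := by simp [cayleyInv]
  have hd : DifferentiableOn ℂ
      (fun ζ => cayley (f w) (f (ofComplex (cayleyInv w ζ)) : ℂ)) (Metric.ball 0 1) := by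
    refine (differentiableOn_cayley (f w)).comp
      ((isAnalyticSelfMap_iff.1 hf).comp (differentiableOn_cayleyInv w) ?_) ?_
    · intro ζ hζ
      exact im_cayleyInv w (by simpa using hζ)
    · intro ζ _
      exact (f _).im_pos
  have hm : MapsTo (fun ζ => cayley (f w) (f (ofComplex (cayleyInv w ζ)) : ℂ))
      (Metric.ball 0 1) (Metric.closedBall 0 1) := by
    intro ζ _
    simpa using (norm_cayley_lt_one (f w) _).le
  -- Schwarz lemma for `f` read in the Cayley charts centred at `w` and `f w`.
  have h := Complex.norm_le_norm_of_mapsTo_ball hd hm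
    (by simp only [h0, ofComplex_apply, cayley_self]) (norm_cayley_lt_one w z)
  simp only [cayleyInv_cayley, ofComplex_apply, norm_cayley] at h
  linarith [tanh_strictMono.le_iff_le.1 h]

/-! ### Analytic self-maps and automorphisms -/

theorem IsAnalyticSelfMap.comp {f g : ℍ → ℍ} (hf : IsAnalyticSelfMap f)
    (hg : IsAnalyticSelfMap g) : IsAnalyticSelfMap (f ∘ g) := by
  rw [isAnalyticSelfMap_iff] at *
  refine (hf.comp hg fun z _ => (g _).im_pos).congr fun z _ => ?_
  simp

theorem isAnalyticSelfMap_id : IsAnalyticSelfMap id := mdifferentiable_coe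

theorem IsAnalyticSelfMap.iterate {f : ℍ → ℍ} (hf : IsAnalyticSelfMap f) (n : ℕ) :
    IsAnalyticSelfMap f^[n] := by
  induction n with
  | zero => exact isAnalyticSelfMap_id
  | succ n ih => exact ih.comp hf

theorem isAnalyticSelfMap_affineMap (c : ℝ) (hc : 0 < c) (b : ℝ) :
    IsAnalyticSelfMap (affineMap c hc b) := by
  rw [isAnalyticSelfMap_iff]
  have : DifferentiableOn ℂ (fun z : ℂ => (c : ℂ) * z + b) {z | 0 < z.im} := by fun_prop
  refine this.congr fun z hz => ?_
  simp [affineMap, ofComplex_apply_of_im_pos hz]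

theorem isAut_of_leftInverse {f g : ℍ → ℍ} (hf : IsAnalyticSelfMap f)
    (hg : IsAnalyticSelfMap g) (h : Function.LeftInverse g f) (h' : Function.RightInverse g f) :
    IsAut f := ⟨hf, g, hg, h, h'⟩

theorem isAut_affineMap (c : ℝ) (hc : 0 < c) (b : ℝ) : IsAut (affineMap c hc b) := by
  have hc' : (c : ℂ) ≠ 0 := by exact_mod_cast hc.ne'
  refine isAut_of_leftInverse (isAnalyticSelfMap_affineMap c hc b)
    (isAnalyticSelfMap_affineMap c⁻¹ (inv_pos.2 hc) (-(b / c))) ?_ ?_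
  all_goals
    intro z
    apply UpperHalfPlane.ext
    simp only [affineMap]
    push_cast
    field_simp
    ring

theorem IsAut.dist_eq {τ : ℍ → ℍ} (hτ : IsAut τ) (z w : ℍ) : dist (τ z) (τ w) = dist z w := by
  obtain ⟨h, η, hη, hl, -⟩ := hτ
  refine le_antisymm (h.dist_le z w) ?_
  simpa only [hl z, hl w] using hη.dist_le (τ z) (τ w)

theorem isAut_renorm (w : ℍ) : IsAut (renorm w) := isAut_affineMap _ _ _

theorem isAut_renormInv (w : ℍ) : IsAut (renormInv w) := isAut_affineMap _ _ _

theorem renorm_im (w z : ℍ) : (renorm w z).im = z.im / w.im := by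
  rw [← coe_im, coe_renorm]
  simp [Complex.div_im]
  field_simp

/-! ### Convergence and compactness of analytic self-maps -/

/-- Pointwise convergence of short maps is continuous convergence. -/
theorem tendsto_prod_of_dist_le {ι X Y : Type*} [PseudoMetricSpace X] [PseudoMetricSpace Y]
    {F : ι → X → Y} {l : Filter ι} {x : X} {y : Y}
    (hF : ∀ n z w, dist (F n z) (F n w) ≤ dist z w) (h : Tendsto (fun n => F n x) l (𝓝 y)) :
    Tendsto (fun p : ι × X => F p.1 p.2) (l ×ˢ 𝓝 x) (𝓝 y) := by
  rw [tendsto_iff_dist_tendsto_zero] at h ⊢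
  have h1 : Tendsto (fun p : ι × X => dist p.2 x + dist (F p.1 x) y) (l ×ˢ 𝓝 x) (𝓝 (0 + 0)) :=
    (tendsto_iff_dist_tendsto_zero.1 tendsto_snd).add (h.comp tendsto_fst)
  rw [add_zero] at h1
  refine squeeze_zero (fun _ => dist_nonneg) (fun p => ?_) h1
  exact (dist_triangle _ (F p.1 x) _).trans (add_le_add_left (hF _ _ _) _)

theorem tendstoLocallyUniformly_of_dist_le {ι X Y : Type*} [PseudoMetricSpace X]
    [PseudoMetricSpace Y] {F : ι → X → Y} {f : X → Y} {l : Filter ι} (hf : Continuous f)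
    (hF : ∀ n z w, dist (F n z) (F n w) ≤ dist z w)
    (h : ∀ x, Tendsto (fun n => F n x) l (𝓝 (f x))) : TendstoLocallyUniformly F f l := by
  rw [tendstoLocallyUniformly_iff_forall_tendsto]
  intro x
  exact (((hf.tendsto x).comp tendsto_snd).prodMk_nhds
    (tendsto_prod_of_dist_le hF (h x))).mono_right (nhds_le_uniformity _)

theorem continuous_of_dist_le {X Y : Type*} [PseudoMetricSpace X] [PseudoMetricSpace Y]
    {f : X → Y} (hf : ∀ z w, dist (f z) (f w) ≤ dist z w) : Continuous f :=
  (LipschitzWith.of_dist_le_mul (K := 1) (by simpa using hf)).continuous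

/-- A pointwise limit of analytic self-maps of `ℍ` is analytic. -/
theorem isAnalyticSelfMap_of_tendsto {ι : Type*} {F : ι → ℍ → ℍ} {f : ℍ → ℍ} {l : Filter ι}
    [l.NeBot] (hF : ∀ n, IsAnalyticSelfMap (F n))
    (h : ∀ z, Tendsto (fun n => F n z) l (𝓝 (f z))) : IsAnalyticSelfMap f := by
  have hf : Continuous f := continuous_of_dist_le fun z w =>
    le_of_tendsto ((h z).dist (h w)) (.of_forall fun n => (hF n).dist_le z w)
  rw [isAnalyticSelfMap_iff]
  have hU : IsOpen {z : ℂ | 0 < z.im} := isOpen_upperHalfPlaneSet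
  refine TendstoLocallyUniformlyOn.differentiableOn (φ := l)
    (F := fun n z => (F n (ofComplex z) : ℂ)) ?_
    (.of_forall fun n => isAnalyticSelfMap_iff.1 (hF n)) hU
  rw [tendstoLocallyUniformlyOn_iff_forall_tendsto]
  intro x hx
  have h1 : Tendsto ofComplex (𝓝[{z | 0 < z.im}] x) (𝓝 (ofComplex x)) :=
    (mdifferentiableAt_ofComplex hx).continuousAt.continuousWithinAt
  have h2 := (tendsto_prod_of_dist_le (fun n => (hF n).dist_le) (h (ofComplex x))).comp
    (tendsto_fst.prodMk (h1.comp tendsto_snd) :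
      Tendsto (fun p : ι × ℂ => (p.1, ofComplex p.2)) (l ×ˢ 𝓝[{z | 0 < z.im}] x) _)
  exact (((continuous_coe.tendsto _).comp ((hf.tendsto _).comp (h1.comp tendsto_snd))).prodMk_nhds
    ((continuous_coe.tendsto _).comp h2)).mono_right (nhds_le_uniformity _)

/-- A compactness principle: along an ultrafilter, analytic self-maps of `ℍ` whose values at one
point stay bounded have a pointwise limit. -/
theorem exists_ultrafilter_limit {ι : Type*} {F : ι → ℍ → ℍ} (𝒰 : Ultrafilter ι)
    (hF : ∀ n, IsAnalyticSelfMap (F n)) {z₀ w₀ : ℍ} {R : ℝ}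
    (hR : ∀ᶠ n in (𝒰 : Filter ι), dist (F n z₀) w₀ ≤ R) :
    ∃ f : ℍ → ℍ, IsAnalyticSelfMap f ∧
      ∀ z, Tendsto (fun n => F n z) (𝒰 : Filter ι) (𝓝 (f z)) := by
  have h : ∀ z, ∃ w, Tendsto (fun n => F n z) (𝒰 : Filter ι) (𝓝 w) := by
    intro z
    have h1 : (𝒰.map fun n => F n z : Filter ℍ) ≤ 𝓟 (Metric.closedBall w₀ (dist z z₀ + R)) := by
      rw [le_principal_iff]
      change ∀ᶠ n in (𝒰 : Filter ι), F n z ∈ Metric.closedBall w₀ (dist z z₀ + R)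
      filter_upwards [hR] with n hn
      rw [Metric.mem_closedBall]
      linarith [dist_triangle (F n z) (F n z₀) w₀, (hF n).dist_le z z₀]
    obtain ⟨w, -, hw⟩ := (isCompact_closedBall w₀ _).ultrafilter_le_nhds _ h1
    exact ⟨w, hw⟩
  choose f hf using h
  exact ⟨f, isAnalyticSelfMap_of_tendsto hF hf, hf⟩

/-! ### Rigidity of maps with prescribed distances to a point -/

/-- The transform equals `1 + (conj w - w) / (u - conj w)`. This boundary value is what pins down
the free rotation in `eq_of_dist_eq`. -/
theorem tendsto_cayley_one (w : ℍ) {ι : Type*} {l : Filter ι} {u : ι → ℂ}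
    (hu : ∀ n, 0 < (u n).im) (h : Tendsto (fun n => ‖u n‖) l atTop) :
    Tendsto (fun n => cayley w (u n)) l (𝓝 1) := by
  have h1 : Tendsto (fun n => ‖u n - conj (w : ℂ)‖) l atTop :=
    tendsto_atTop_mono (fun n => norm_sub_norm_le (u n) _)
      (tendsto_atTop_add_const_right l (-‖conj (w : ℂ)‖) h)
  have h2 : Tendsto (fun n => 1 + (conj (w : ℂ) - w) * (u n - conj (w : ℂ))⁻¹) l
      (𝓝 (1 + (conj (w : ℂ) - w) * 0)) :=
    ((tendsto_inv₀_cobounded.comp (tendsto_norm_atTop_iff_cobounded.1 h1)).const_mul _).const_add _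
  rw [mul_zero, add_zero] at h2
  refine h2.congr fun n => ?_
  have := sub_conj_ne_zero w (hu n)
  rw [cayley]
  field_simp
  ring

theorem isConnected_upperHalfPlane : IsConnected {z : ℂ | 0 < z.im} :=
  Complex.isConnected_of_upperHalfPlane subset_rfl (by grind)

/-- Two holomorphic functions on `ℍ` with the same modulus differ by a constant factor. -/
theorem exists_eq_mul_of_norm_eq {G H : ℂ → ℂ} (hG : DifferentiableOn ℂ G {z | 0 < z.im})
    (hH : DifferentiableOn ℂ H {z | 0 < z.im}) (h : ∀ z : ℂ, 0 < z.im → ‖G z‖ = ‖H z‖)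
    {z₁ : ℂ} (hz₁ : 0 < z₁.im) (h1 : G z₁ ≠ 0) : ∃ c : ℂ, ∀ z : ℂ, 0 < z.im → H z = c * G z := by
  have hU : IsOpen {z : ℂ | 0 < z.im} := isOpen_upperHalfPlaneSet
  obtain ⟨r, hr, hb⟩ := Metric.mem_nhds_iff.1 (inter_mem (hU.mem_nhds hz₁)
    ((hG.continuousOn.continuousAt (hU.mem_nhds hz₁)).eventually_ne h1))
  have hd : DifferentiableOn ℂ (fun z => H z / G z) (Metric.ball z₁ r) :=
    (hH.mono fun z hz => (hb hz).1).div (hG.mono fun z hz => (hb hz).1) fun z hz => (hb hz).2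
  have hn : ∀ z ∈ Metric.ball z₁ r, ‖H z / G z‖ = 1 := fun z hz => by
    rw [norm_div, h z (hb hz).1, div_self]
    rw [← h z (hb hz).1]
    exact norm_ne_zero_iff.2 (hb hz).2
  have hz₁r := Metric.mem_ball_self (x := z₁) hr
  -- The quotient has modulus `1` throughout the ball, so its centre is a maximum and the maximum
  -- principle makes it constant; the identity theorem then extends this to `ℍ`.
  have hc := Complex.eqOn_of_isPreconnected_of_isMaxOn_norm (convex_ball z₁ r).isPreconnected
    Metric.isOpen_ball hd hz₁r fun z hz => by
      change ‖H z / G z‖ ≤ ‖H z₁ / G z₁‖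
      rw [hn z hz, hn z₁ hz₁r]
  refine ⟨H z₁ / G z₁, fun z hz => ?_⟩
  refine (hH.analyticOnNhd hU).eqOn_of_preconnected_of_eventuallyEq
    ((hG.const_mul _).analyticOnNhd hU) isConnected_upperHalfPlane.isPreconnected hz₁ ?_ hz
  filter_upwards [Metric.ball_mem_nhds z₁ hr] with z hz
  rw [← div_eq_iff (hb hz).2]
  exact hc hz

/-- Analytic self-maps of `ℍ` whose values are always at the same distance from a point `w` agree if
both tend to `∞` along a common sequence. -/
theorem eq_of_dist_eq {f g : ℍ → ℍ} (hf : IsAnalyticSelfMap f) (hg : IsAnalyticSelfMap g) {w : ℍ}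
    (h : ∀ z, dist (f z) w = dist (g z) w) {u : ℕ → ℍ}
    (hfu : Tendsto (fun n => ‖(f (u n) : ℂ)‖) atTop atTop)
    (hgu : Tendsto (fun n => ‖(g (u n) : ℂ)‖) atTop atTop) : f = g := by
  have hF := tendsto_cayley_one w (fun n => (f (u n)).im_pos) hfu
  have hG := tendsto_cayley_one w (fun n => (g (u n)).im_pos) hgu
  obtain ⟨n, hn⟩ := (hF.eventually_ne one_ne_zero).exists
  obtain ⟨c, hc⟩ := exists_eq_mul_of_norm_eq
    (G := fun z => cayley w (f (ofComplex z))) (H := fun z => cayley w (g (ofComplex z)))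
    ((differentiableOn_cayley w).comp (isAnalyticSelfMap_iff.1 hf) fun z _ => (f _).im_pos)
    ((differentiableOn_cayley w).comp (isAnalyticSelfMap_iff.1 hg) fun z _ => (g _).im_pos)
    (fun z _ => by rw [norm_cayley, norm_cayley, h])
    (u n).im_pos (by simpa using hn)
  have hc' : ∀ z : ℍ, cayley w (g z) = c * cayley w (f z) := fun z => by
    simpa using hc z z.im_pos
  have hc1 : 1 = c * 1 := tendsto_nhds_unique hG ((hF.const_mul c).congr fun n => (hc' (u n)).symm)
  funext z
  apply UpperHalfPlane.ext
  refine cayley_injOn w (f z).im_pos (g z).im_pos ?_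
  rw [hc' z, ← mul_one c, ← hc1, one_mul]

/-! ### Limit distance of two orbits -/

/-- The limit of the hyperbolic distances between the points of two forward orbits. -/
noncomputable def orbitDist (φ : ℍ → ℍ) (z w : ℍ) : ℝ := ⨅ n : ℕ, dist (φ^[n] z) (φ^[n] w)

variable {φ : ℍ → ℍ}

theorem tendsto_orbitDist (hφ : IsAnalyticSelfMap φ) (z w : ℍ) :
    Tendsto (fun n : ℕ => dist (φ^[n] z) (φ^[n] w)) atTop (𝓝 (orbitDist φ z w)) := by
  refine tendsto_atTop_ciInf (antitone_nat_of_succ_le fun n => ?_)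
    ⟨0, by rintro _ ⟨n, rfl⟩; exact dist_nonneg⟩
  rw [Function.iterate_succ_apply', Function.iterate_succ_apply']
  exact hφ.dist_le _ _

theorem orbitDist_map (hφ : IsAnalyticSelfMap φ) (z w : ℍ) :
    orbitDist φ (φ z) (φ w) = orbitDist φ z w :=
  tendsto_nhds_unique (tendsto_orbitDist hφ _ _)
    ((tendsto_add_atTop_iff_nat 1).2 (tendsto_orbitDist hφ z w))

theorem orbitDist_iterate (hφ : IsAnalyticSelfMap φ) (n : ℕ) (z w : ℍ) :
    orbitDist φ (φ^[n] z) (φ^[n] w) = orbitDist φ z w := by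
  induction n with
  | zero => rfl
  | succ n ih => rw [Function.iterate_succ_apply', Function.iterate_succ_apply',
      orbitDist_map hφ, ih]

theorem hasLimitStep_orbitDist (hφ : IsAnalyticSelfMap φ) (z : ℍ) :
    HasLimitStep φ z (orbitDist φ z (φ z)) := tendsto_orbitDist hφ z (φ z)

/-! ### Escape of orbits to infinity -/

section Escape

variable {g : ℍ → ℍ}

theorem im_le_im_iterate (hi : ∀ z, (g z).im ≤ (g (φ z)).im) (z : ℍ) :
    Monotone fun n : ℕ => (g (φ^[n] z)).im := by
  refine monotone_nat_of_le_succ fun n => ?_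
  rw [Function.iterate_succ_apply']
  exact hi _

/-- The difference `g ∘ φ - g` is holomorphic and real-valued on a connected open set, hence
constant. -/
theorem exists_eq_add_of_im_eq (hφ : IsAnalyticSelfMap φ) (hg : IsAnalyticSelfMap g)
    (h : ∀ z, (g (φ z)).im = (g z).im) : ∃ c : ℂ, ∀ z, (g (φ z) : ℂ) = g z + c := by
  obtain ⟨c, hc⟩ := AnalyticOnNhd.eq_const_of_im_eq_const (c₀ := 0)
    (((isAnalyticSelfMap_iff.1 (hg.comp hφ)).sub (isAnalyticSelfMap_iff.1 hg)).analyticOnNhd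
      isOpen_upperHalfPlaneSet)
    (fun z _ => by simp [h]) isOpen_upperHalfPlaneSet isConnected_upperHalfPlane
  refine ⟨c, fun z => ?_⟩
  have := hc z z.im_pos
  simp only [Pi.sub_apply, Function.comp_apply, ofComplex_apply] at this
  linear_combination this

/-- If the distances were below some `b` infinitely often, `g ∘ φ^[n]` would have a limit `G` along
an ultrafilter of such times, still realizing `orbitDist`. Heights increase along orbits, so `G ∘ φ`
and `G` have equal imaginary part and differ by a translation `c`. Boundedness forces `c = 0`, hence
a vanishing limit step at `z₀`, against `h0`. -/
theorem tendsto_orbitDist_atTop (hφ : IsAnalyticSelfMap φ) (hg : IsAnalyticSelfMap g)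
    (hd : ∀ z w, dist (g z) (g w) = orbitDist φ z w) (hi : ∀ z, (g z).im ≤ (g (φ z)).im)
    {z₀ : ℍ} (h0 : g (φ z₀) ≠ g z₀) :
    Tendsto (fun n : ℕ => orbitDist φ (φ^[n] z₀) z₀) atTop atTop := by
  by_contra hcon
  rw [tendsto_atTop] at hcon
  push Not at hcon
  obtain ⟨b, hb⟩ := hcon
  have hne : (atTop ⊓ 𝓟 {n : ℕ | orbitDist φ (φ^[n] z₀) z₀ < b}).NeBot :=
    frequently_mem_iff_neBot.1 hb
  have h𝒱 := Ultrafilter.of_le (atTop ⊓ 𝓟 {n : ℕ | orbitDist φ (φ^[n] z₀) z₀ < b})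
  set 𝒱 := Ultrafilter.of (atTop ⊓ 𝓟 {n : ℕ | orbitDist φ (φ^[n] z₀) z₀ < b})
  have hT : (𝒱 : Filter ℕ) ≤ atTop := h𝒱.trans inf_le_left
  have hB : ∀ᶠ n in (𝒱 : Filter ℕ), orbitDist φ (φ^[n] z₀) z₀ < b :=
    le_principal_iff.1 (h𝒱.trans inf_le_right)
  obtain ⟨G, hG, hlim⟩ := exists_ultrafilter_limit 𝒱 (F := fun n => g ∘ φ^[n])
    (fun n => hg.comp (hφ.iterate n)) (z₀ := z₀) (w₀ := g z₀) (R := b)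
    (by filter_upwards [hB] with n hn using (hd _ _).trans_le hn.le)
  have hGd : ∀ z w, dist (G z) (G w) = orbitDist φ z w := fun z w =>
    tendsto_nhds_unique ((hlim z).dist (hlim w)) (tendsto_const_nhds.congr fun n => by
      simp only [Function.comp_apply, hd, orbitDist_iterate hφ])
  -- The ultrafilter need not be shift-invariant; monotonicity upgrades the convergence of heights
  -- to the full sequence, where shifting `n` is harmless.
  have hGi : ∀ z, Tendsto (fun n : ℕ => (g (φ^[n] z)).im) atTop (𝓝 (G z).im) := by
    intro z
    have h1 := (continuous_im.tendsto _).comp (hlim z)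
    rcases tendsto_atTop_of_monotone (im_le_im_iterate hi z) with h | ⟨l, h⟩
    · exact absurd h1 (not_tendsto_nhds_of_tendsto_atTop (h.mono_left hT) _)
    · rwa [tendsto_nhds_unique h1 (h.mono_left hT)]
  obtain ⟨c, hc⟩ := exists_eq_add_of_im_eq hφ hG fun z =>
    tendsto_nhds_unique (hGi (φ z)) ((tendsto_add_atTop_iff_nat 1).2 (hGi z))
  have hcn : ∀ n : ℕ, (G (φ^[n] z₀) : ℂ) = G z₀ + n * c := by
    intro n
    induction n with
    | zero => simp
    | succ n ih =>
      rw [Function.iterate_succ_apply', hc, ih]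
      push_cast
      ring
  have hc0 : c = 0 := by
    by_contra hc0
    have h1 : Tendsto (fun n : ℕ => (n : ℝ) * ‖c‖) (𝒱 : Filter ℕ) atTop :=
      (tendsto_natCast_atTop_atTop.atTop_mul_const (norm_pos_iff.2 hc0)).mono_left hT
    obtain ⟨n, hn, hn'⟩ :=
      ((h1.eventually_gt_atTop ((G z₀).im * (Real.exp b - 1))).and hB).exists
    -- A hyperbolic bound `b` at the fixed point `G z₀` bounds the Euclidean displacement `n * ‖c‖`.
    have h2 := dist_coe_le (G (φ^[n] z₀)) (G z₀)
    rw [hcn, dist_eq_norm, add_sub_cancel_left, norm_mul, Complex.norm_natCast, hGd] at h2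
    have h3 := mul_le_mul_of_nonneg_left
      (sub_le_sub_right (Real.exp_le_exp.2 hn'.le) 1) (G z₀).im_pos.le
    linarith
  apply h0
  rw [← dist_eq_zero, hd, ← hGd, dist_eq_zero]
  apply UpperHalfPlane.ext
  rw [hc, hc0, add_zero]

/-- Along the orbit the heights stay above `(g z₀).im`, so Euclidean distance to `g z₀` is at least
`(g z₀).im` times hyperbolic distance, which tends to infinity. -/
theorem tendsto_norm_atTop (hφ : IsAnalyticSelfMap φ) (hg : IsAnalyticSelfMap g)
    (hd : ∀ z w, dist (g z) (g w) = orbitDist φ z w) (hi : ∀ z, (g z).im ≤ (g (φ z)).im)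
    {z₀ : ℍ} (h0 : g (φ z₀) ≠ g z₀) :
    Tendsto (fun n : ℕ => ‖(g (φ^[n] z₀) : ℂ)‖) atTop atTop := by
  have hpos := (g z₀).im_pos
  refine tendsto_atTop_mono (fun n => ?_) (tendsto_atTop_add_const_right atTop (-‖(g z₀ : ℂ)‖)
    ((tendsto_orbitDist_atTop hφ hg hd hi h0).const_mul_atTop hpos))
  have h1 := dist_le_dist_coe_div_sqrt (g (φ^[n] z₀)) (g z₀)
  have h2 : (g z₀).im ≤ (g (φ^[n] z₀)).im := im_le_im_iterate hi z₀ (Nat.zero_le n)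
  have h3 : (g z₀).im ≤ √((g (φ^[n] z₀)).im * (g z₀).im) :=
    Real.le_sqrt_of_sq_le (by nlinarith)
  rw [hd, le_div_iff₀ (hpos.trans_le h3), dist_eq_norm] at h1
  have h4 : 0 ≤ orbitDist φ (φ^[n] z₀) z₀ := hd _ _ ▸ dist_nonneg
  have h5 := norm_sub_le (g (φ^[n] z₀) : ℂ) (g z₀)
  nlinarith [mul_le_mul_of_nonneg_left h3 h4]

end Escape

/-! ### Upper bound for solutions, and limits of renormalized iterates -/

theorem dist_forwardSolution_le {φ σ τ : ℍ → ℍ} (hφ : IsAnalyticSelfMap φ)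
    (h : (σ, τ) ∈ forwardSolutions φ) (z w : ℍ) : dist (σ z) (σ w) ≤ orbitDist φ z w := by
  obtain ⟨hσ, -, hτ, hc⟩ := h
  have hn : ∀ n : ℕ, dist (σ (φ^[n] z)) (σ (φ^[n] w)) = dist (σ z) (σ w) := by
    intro n
    induction n with
    | zero => rfl
    | succ n ih =>
      have hc' : ∀ z, σ (φ z) = τ (σ z) := fun z => congrFun hc z
      rw [Function.iterate_succ_apply', Function.iterate_succ_apply', hc', hc', hτ.dist_eq, ih]
  exact ge_of_tendsto' (tendsto_orbitDist hφ z w) fun n => (hn n).symm.trans_le (hσ.dist_le _ _)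

/-- Thus `γ_n ∘ γ_{n+1}⁻¹` is determined by the single point `γ_n z_{n+1}`, and it converges once
that point does. -/
theorem renorm_renormInv_eq (w v z : ℍ) :
    renorm w (renormInv v z) = renormInv (renorm w v) z := by
  have h : (w.im : ℂ) ≠ 0 := by exact_mod_cast w.im_ne_zero
  have h1 : ∀ v z : ℍ, (renormInv v z : ℂ) = v.im * z + v.re := fun _ _ => rfl
  have h2 := re_add_im (renorm w v)
  have h3 := re_add_im v
  apply UpperHalfPlane.ext
  rw [coe_renorm, h1, h1, renorm_im, eq_sub_of_add_eq h2, coe_renorm, renorm_im,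
    eq_sub_of_add_eq h3]
  push_cast
  field_simp
  ring

section Limits

variable {φ : ℍ → ℍ} {z₀ : ℍ}

theorem isAnalyticSelfMap_renorm_iterate (hφ : IsAnalyticSelfMap φ) (z₀ : ℍ) (n : ℕ) :
    IsAnalyticSelfMap fun z => renorm (φ^[n] z₀) (φ^[n] z) :=
  (isAut_renorm _).1.comp (hφ.iterate n)

theorem exists_renorm_limit (hφ : IsAnalyticSelfMap φ) (z₀ : ℍ) (𝒰 : Ultrafilter ℕ) :
    ∃ g : ℍ → ℍ, IsAnalyticSelfMap g ∧
      ∀ z, Tendsto (fun n => renorm (φ^[n] z₀) (φ^[n] z)) (𝒰 : Filter ℕ) (𝓝 (g z)) :=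
  exists_ultrafilter_limit 𝒰 (isAnalyticSelfMap_renorm_iterate hφ z₀) (z₀ := z₀) (w₀ := I) (R := 0)
    (.of_forall fun n => by rw [renorm_self, dist_self])

variable {g : ℍ → ℍ} {l : Filter ℕ} [l.NeBot]

theorem renorm_limit_self
    (h : ∀ z, Tendsto (fun n => renorm (φ^[n] z₀) (φ^[n] z)) l (𝓝 (g z))) : g z₀ = I :=
  tendsto_nhds_unique (h z₀) (tendsto_const_nhds.congr fun _ => (renorm_self _).symm)

theorem dist_renorm_limit (hφ : IsAnalyticSelfMap φ) (hl : l ≤ atTop)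
    (h : ∀ z, Tendsto (fun n => renorm (φ^[n] z₀) (φ^[n] z)) l (𝓝 (g z))) (z w : ℍ) :
    dist (g z) (g w) = orbitDist φ z w :=
  tendsto_nhds_unique ((h z).dist (h w)) (((tendsto_orbitDist hφ z w).mono_left hl).congr
    fun _ => ((isAut_renorm _).dist_eq _ _).symm)

theorem im_renorm_limit_le (hi : ∀ z, z.im ≤ (φ z).im)
    (h : ∀ z, Tendsto (fun n => renorm (φ^[n] z₀) (φ^[n] z)) l (𝓝 (g z))) (z : ℍ) :
    (g z).im ≤ (g (φ z)).im := by
  refine le_of_tendsto_of_tendsto' ((continuous_im.tendsto _).comp (h z))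
    ((continuous_im.tendsto _).comp (h (φ z))) fun n => ?_
  simp only [Function.comp_apply, renorm_im]
  rw [← Function.iterate_succ_apply, Function.iterate_succ_apply']
  exact div_le_div_of_nonneg_right (hi _) (im_pos _).le

end Limits

/-! ### Positive limit step: convergence and the functional equation -/

section NonZeroStep

variable {φ : ℍ → ℍ}

theorem exists_tendsto_renorm (hφ : IsAnalyticSelfMap φ) (hi : ∀ z, z.im ≤ (φ z).im) {z₀ : ℍ}
    (h0 : orbitDist φ z₀ (φ z₀) ≠ 0) :
    ∃ g : ℍ → ℍ, IsAnalyticSelfMap g ∧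
      ∀ z, Tendsto (fun n => renorm (φ^[n] z₀) (φ^[n] z)) atTop (𝓝 (g z)) := by
  have key : ∀ (𝒰 : Ultrafilter ℕ) (g : ℍ → ℍ), (𝒰 : Filter ℕ) ≤ atTop → IsAnalyticSelfMap g →
      (∀ z, Tendsto (fun n => renorm (φ^[n] z₀) (φ^[n] z)) (𝒰 : Filter ℕ) (𝓝 (g z))) →
      Tendsto (fun n : ℕ => ‖(g (φ^[n] z₀) : ℂ)‖) atTop atTop := by
    intro 𝒰 g h𝒰 hg h
    have hd := dist_renorm_limit hφ h𝒰 h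
    refine tendsto_norm_atTop hφ hg hd (im_renorm_limit_le hi h) fun heq => h0 ?_
    rw [← hd, heq, dist_self]
  have h𝒰 := Ultrafilter.of_le (atTop : Filter ℕ)
  obtain ⟨g, hg, hlim⟩ := exists_renorm_limit hφ z₀ (Ultrafilter.of atTop)
  -- Convergence of the full sequence is tested on every ultrafilter `𝒱 ≤ atTop`; rigidity
  -- identifies each limit with the one fixed `g`.
  refine ⟨g, hg, fun z => tendsto_iff_ultrafilter _ _ _ |>.2 fun 𝒱 h𝒱 => ?_⟩
  obtain ⟨g', hg', hlim'⟩ := exists_renorm_limit hφ z₀ 𝒱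
  have : g' = g := by
    refine eq_of_dist_eq hg' hg (w := I) (fun z => ?_) (key 𝒱 g' h𝒱 hg' hlim')
      (key _ g h𝒰 hg hlim)
    have h1 := dist_renorm_limit hφ h𝒱 hlim' z z₀
    have h2 := dist_renorm_limit hφ h𝒰 hlim z z₀
    rw [renorm_limit_self hlim'] at h1
    rw [renorm_limit_self hlim] at h2
    rw [h1, h2]
  exact this ▸ hlim' z

theorem tendsto_renormInv {ι : Type*} {l : Filter ι} {w : ι → ℍ} {w₀ : ℍ}
    (h : Tendsto w l (𝓝 w₀)) (z : ℍ) :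
    Tendsto (fun n => renormInv (w n) z) l (𝓝 (renormInv w₀ z)) := by
  rw [isEmbedding_coe.tendsto_nhds_iff]
  have h1 : Continuous fun w : ℍ => (w.im : ℂ) * (z : ℂ) + (w.re : ℂ) :=
    ((Complex.continuous_ofReal.comp continuous_im).mul continuous_const).add
      (Complex.continuous_ofReal.comp continuous_re)
  exact (h1.tendsto w₀).comp h

/-- If the limit step at `z₀` is positive, the renormalized iterates converge to a solution of the
forward functional equation which realizes the limit distances of orbits. -/
theorem exists_isRenormalizationPair (hφ : IsAnalyticSelfMap φ) (hi : ∀ z, z.im ≤ (φ z).im)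
    {z₀ : ℍ} (h0 : orbitDist φ z₀ (φ z₀) ≠ 0) :
    ∃ g α : ℍ → ℍ, IsRenormalizationPair φ z₀ g α ∧ (g, α) ∈ forwardSolutions φ ∧
      ∀ z w, dist (g z) (g w) = orbitDist φ z w := by
  obtain ⟨g, hg, hlim⟩ := exists_tendsto_renorm hφ hi h0
  have hd := dist_renorm_limit hφ le_rfl hlim
  have hα : ∀ (n : ℕ) (z : ℍ), renorm (φ^[n] z₀) (renormInv (φ^[n + 1] z₀) z)
      = renormInv (renorm (φ^[n] z₀) (φ^[n] (φ z₀))) z := fun n z => renorm_renormInv_eq _ _ _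
  have hαd : ∀ (n : ℕ) (z w : ℍ), dist (renorm (φ^[n] z₀) (renormInv (φ^[n + 1] z₀) z))
      (renorm (φ^[n] z₀) (renormInv (φ^[n + 1] z₀) w)) ≤ dist z w := fun n z w => by
    rw [(isAut_renorm _).dist_eq, (isAut_renormInv _).dist_eq]
  have hαlim : ∀ z, Tendsto (fun n => renorm (φ^[n] z₀) (renormInv (φ^[n + 1] z₀) z)) atTop
      (𝓝 (renormInv (g (φ z₀)) z)) := fun z => by
    simp only [hα]
    exact tendsto_renormInv (hlim (φ z₀)) z
  have hgne : g (φ z₀) ≠ g z₀ := fun h => h0 (by rw [← hd, h, dist_self])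
  refine ⟨g, renormInv (g (φ z₀)), ⟨?_, ?_, ⟨_, _, _, rfl⟩⟩,
    ⟨hg, ⟨_, _, hgne⟩, isAut_renormInv _, ?_⟩, hd⟩
  · exact tendstoLocallyUniformly_of_dist_le (continuous_of_dist_le hg.dist_le)
      (fun n => (isAnalyticSelfMap_renorm_iterate hφ z₀ n).dist_le) hlim
  · exact tendstoLocallyUniformly_of_dist_le
      (continuous_of_dist_le (isAut_renormInv _).1.dist_le) hαd hαlim
  · funext z
    -- With `z_n = φ_n z₀` and `γ_n = renorm z_n`, the limit is taken in `γ_n (φ_n (φ z)) = (γ_n ∘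
    -- γ_{n+1}⁻¹) (γ_{n+1} (φ_{n+1} z))`; the moving argument requires continuous convergence.
    have h1 : Tendsto (fun n : ℕ => (n, renorm (φ^[n + 1] z₀) (φ^[n + 1] z))) atTop
        (atTop ×ˢ 𝓝 (g z)) := tendsto_id.prodMk ((tendsto_add_atTop_iff_nat 1).2 (hlim z))
    have h2 := (tendsto_prod_of_dist_le hαd (hαlim (g z))).comp h1
    refine tendsto_nhds_unique (hlim (φ z)) (h2.congr fun n => ?_)
    simp only [Function.comp_apply]
    rw [renormInv_renorm, Function.iterate_succ_apply]

end NonZeroStep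

/-! ### Zero limit step: all orbits merge -/

section ZeroStep

variable {φ : ℍ → ℍ} {z₀ : ℍ}

/-- A non-constant analytic self-map of `ℍ` is open. -/
theorem IsAnalyticSelfMap.isOpen_range {g : ℍ → ℍ} (hg : IsAnalyticSelfMap g)
    (hne : ∃ z w, g z ≠ g w) : IsOpen (range g) := by
  have hU : IsOpen {z : ℂ | 0 < z.im} := isOpen_upperHalfPlaneSet
  rcases ((isAnalyticSelfMap_iff.1 hg).analyticOnNhd hU).is_constant_or_isOpen
    isConnected_upperHalfPlane.isPreconnected with ⟨c, hc⟩ | h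
  · obtain ⟨z, w, hzw⟩ := hne
    refine absurd (UpperHalfPlane.ext ?_) hzw
    simpa using (hc z z.im_pos).trans (hc w w.im_pos).symm
  · convert (h _ subset_rfl hU).preimage continuous_coe
    ext w
    simp only [mem_range, mem_preimage, mem_image, mem_ofPred_eq]
    constructor
    · rintro ⟨z, rfl⟩
      exact ⟨z, z.im_pos, by rw [ofComplex_apply]⟩
    · rintro ⟨z, -, hz⟩
      exact ⟨ofComplex z, UpperHalfPlane.ext hz⟩

/-- Analytic self-maps of `ℍ` which fix `z` and converge to the identity near `z` along a filter
`l` are eventually so close to the identity that they separate `z` from the nearby points. -/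
theorem exists_eventually_separates {ι : Type*} {k : ι → ℍ → ℍ} {l : Filter ι}
    (hk : ∀ n, IsAnalyticSelfMap (k n)) {z : ℍ} (hz : ∀ n, k n z = z) {S : Set ℍ} (hS : S ∈ 𝓝 z)
    (h : ∀ w ∈ S, Tendsto (fun n => k n w) l (𝓝 w)) :
    ∃ V ∈ 𝓝 z, ∀ᶠ n in l, ∀ w ∈ V, k n w = z → w = z := by
  obtain ⟨r, hr, hrS⟩ := Metric.nhds_basis_closedBall.mem_iff.1
    ((isOpenEmbedding_coe.isOpenMap.image_mem_nhds hS))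
  have hb : Metric.closedBall (z : ℂ) r ⊆ {w | 0 < w.im} := fun w hw => by
    obtain ⟨w', -, rfl⟩ := hrS hw
    exact w'.im_pos
  have hunif : TendstoUniformlyOn (fun n (w : ℂ) => (k n (ofComplex w) : ℂ)) (fun w => w) l
      (Metric.closedBall (z : ℂ) r) := by
    rw [← tendstoLocallyUniformlyOn_iff_tendstoUniformlyOn_of_compact (isCompact_closedBall _ _),
      tendstoLocallyUniformlyOn_iff_forall_tendsto]
    intro x hx
    obtain ⟨x, hxS, rfl⟩ := hrS hx
    have h1 : Tendsto ofComplex (𝓝[Metric.closedBall (z : ℂ) r] (x : ℂ)) (𝓝 x) := by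
      have := (mdifferentiableAt_ofComplex x.im_pos).continuousAt.tendsto
      rw [ofComplex_apply] at this
      exact this.mono_left nhdsWithin_le_nhds
    have h2 := (tendsto_prod_of_dist_le (fun n => (hk n).dist_le) (h x hxS)).comp
      (tendsto_fst.prodMk (h1.comp tendsto_snd) :
        Tendsto (fun p : ι × ℂ => (p.1, ofComplex p.2)) (l ×ˢ _) _)
    have h3 : Tendsto (fun p : ι × ℂ => p.2) (l ×ˢ 𝓝[Metric.closedBall (z : ℂ) r] (x : ℂ))
        (𝓝 (x : ℂ)) := tendsto_snd.mono_right nhdsWithin_le_nhds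
    exact (h3.prodMk_nhds ((continuous_coe.tendsto _).comp h2)).mono_right (nhds_le_uniformity _)
  refine ⟨_, continuous_coe.continuousAt (Metric.ball_mem_nhds (z : ℂ) hr), ?_⟩
  -- With error below `r / 2` on the ball of radius `r`, Schwarz applied to `k n - id`, which
  -- vanishes at `z`, gives `‖k n w - w‖ ≤ ‖w - z‖ / 2`; if `k n w = z`, this forces `w = z`.
  filter_upwards [Metric.tendstoUniformlyOn_iff.1 hunif (r / 2) (by positivity)] with n hn w hw hkw
  have hw' : (w : ℂ) ∈ Metric.ball (z : ℂ) r := hw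
  have hd : DifferentiableOn ℂ (fun w : ℂ => (k n (ofComplex w) : ℂ) - w)
      (Metric.ball (z : ℂ) r) :=
    ((isAnalyticSelfMap_iff.1 (hk n)).mono (Metric.ball_subset_closedBall.trans hb)).sub
      differentiableOn_id
  have hm : MapsTo (fun w : ℂ => (k n (ofComplex w) : ℂ) - w) (Metric.ball (z : ℂ) r)
      (Metric.closedBall ((k n (ofComplex (z : ℂ)) : ℂ) - z) (r / 2)) := fun w hw => by
    have := hn w (Metric.ball_subset_closedBall hw)
    rw [dist_comm, dist_eq_norm] at this
    simpa [hz] using this.le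
  have h1 := Complex.dist_le_div_mul_dist_of_mapsTo_ball hd hm hw'
  simp only [ofComplex_apply, hz, hkw, sub_self, dist_zero_right] at h1
  rw [show r / 2 / r = 1 / 2 by field_simp, dist_comm, dist_eq_norm] at h1
  apply UpperHalfPlane.ext
  rw [eq_comm, ← sub_eq_zero, ← norm_le_zero_iff]
  linarith

/-- If the hyperbolic steps of all orbits tend to zero, then any two orbits approach each other. -/
theorem orbitDist_eq_zero (hφ : IsAnalyticSelfMap φ) (hne : ∀ z, φ z ≠ z) (h0 : ZeroStep φ)
    (z w : ℍ) : orbitDist φ z w = 0 := by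
  have h𝒰 := Ultrafilter.of_le (atTop : Filter ℕ)
  set 𝒰 := Ultrafilter.of (atTop : Filter ℕ)
  obtain ⟨g, hg, hlim⟩ := exists_renorm_limit hφ z 𝒰
  have hd := dist_renorm_limit hφ h𝒰 hlim
  have hgφ : ∀ v, g (φ v) = g v := fun v => by
    rw [eq_comm, ← dist_eq_zero, hd]
    exact tendsto_nhds_unique (hasLimitStep_orbitDist hφ v) (h0 v)
  have hgn : ∀ (n : ℕ) v, g (φ^[n] v) = g v := fun n v => by
    induction n with
    | zero => rfl
    | succ n ih => rw [Function.iterate_succ_apply', hgφ, ih]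
  have hI := renorm_limit_self hlim
  by_contra hcon
  have hopen := hg.isOpen_range ⟨z, w, fun h => hcon (by rw [← hd, h, dist_self])⟩
  -- The maps `k_n = g ∘ γ_n⁻¹` fix `I` and send `γ_n (φ_n v)` to `g v`. Since `γ_n (φ_n v)` tends
  -- to `g v`, they converge to the identity on `range g`, an open neighbourhood of `I`.
  have hkd : ∀ n : ℕ, IsAnalyticSelfMap (g ∘ renormInv (φ^[n] z)) := fun n =>
    hg.comp (isAut_renormInv _).1
  have hkg : ∀ (n : ℕ) v, (g ∘ renormInv (φ^[n] z)) (renorm (φ^[n] z) (φ^[n] v)) = g v :=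
    fun n v => by rw [Function.comp_apply, renormInv_renorm, hgn]
  obtain ⟨V, hV, hsep⟩ := exists_eventually_separates (l := (𝒰 : Filter ℕ)) hkd (z := I)
    (fun n => by simpa only [renorm_self, hI] using hkg n z)
    (hopen.mem_nhds ⟨z, hI⟩) (by
      rintro _ ⟨v, rfl⟩
      rw [tendsto_iff_dist_tendsto_zero]
      refine squeeze_zero (fun _ => dist_nonneg) (fun n => ?_)
        (tendsto_iff_dist_tendsto_zero.1 (hlim v))
      have := (hkd n).dist_le (renorm (φ^[n] z) (φ^[n] v)) (g v)
      rwa [hkg, dist_comm] at this)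
  have hlimφ := hlim (φ z)
  rw [hgφ, hI] at hlimφ
  -- The point `γ_n (φ_n (φ z))` tends to `I` and `k_n` maps it to `I`, so for some `n` it equals
  -- `I`: then `φ_n z` is a fixed point of `φ`.
  obtain ⟨n, hn, hnV⟩ := (hsep.and (hlimφ.eventually_mem hV)).exists
  have h1 := hn _ hnV (by rw [hkg, hgφ, hI])
  rw [← renorm_self (φ^[n] z)] at h1
  have h2 := congrArg (renormInv (φ^[n] z)) h1
  rw [renormInv_renorm, renormInv_renorm, ← Function.iterate_succ_apply,
    Function.iterate_succ_apply'] at h2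
  exact hne _ h2

end ZeroStep

/-! ### Consequences of the normal form -/

namespace IsNormalForm

variable {φ : ℍ → ℍ} {A : ℝ}

theorem mul_im_lt (hφ : IsNormalForm φ A) (z : ℍ) : A * z.im < (φ z).im := by
  have := hφ.im_pos z
  simpa using this

theorem im_lt (hφ : IsNormalForm φ A) (z : ℍ) : z.im < (φ z).im := by
  nlinarith [hφ.mul_im_lt z, hφ.one_le, z.im_pos]

theorem ne_self (hφ : IsNormalForm φ A) (z : ℍ) : φ z ≠ z := fun h => by
  have := hφ.im_lt z
  rw [h] at this
  exact this.false

/-- Each application of `φ` multiplies the height by more than `A`, and `log ∘ im` is 1-Lipschitz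
for the hyperbolic distance. Hence a hyperbolic map has positive limit step. -/
theorem log_le_orbitDist (hφ : IsNormalForm φ A) (z : ℍ) :
    Real.log A ≤ orbitDist φ z (φ z) := by
  refine le_ciInf fun n => ?_
  have hA : 0 < A := one_pos.trans_le hφ.one_le
  have h1 := hφ.mul_im_lt (φ^[n] z)
  have h2 := Real.log_le_log (mul_pos hA (φ^[n] z).im_pos) h1.le
  rw [Real.log_mul hA.ne' (φ^[n] z).im_ne_zero] at h2
  have h3 := dist_log_im_le (φ^[n] z) (φ (φ^[n] z))
  rw [Real.dist_eq, abs_sub_comm] at h3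
  rw [← Function.iterate_succ_apply, Function.iterate_succ_apply']
  linarith [le_abs_self (Real.log (φ (φ^[n] z)).im - Real.log (φ^[n] z).im)]

theorem orbitDist_pos (hφ : IsNormalForm φ A) (h : 1 < A ∨ (A = 1 ∧ NonZeroStep φ)) (z : ℍ) :
    0 < orbitDist φ z (φ z) := by
  rcases h with h | ⟨-, h⟩
  · exact (Real.log_pos h).trans_le (hφ.log_le_orbitDist z)
  · obtain ⟨s, hs, hlim⟩ := h z
    rwa [tendsto_nhds_unique (hasLimitStep_orbitDist hφ.analytic z) hlim]

end IsNormalForm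

end HalfPlaneDynamics

theorem mainTheorem9 (φ : ℍ → ℍ) (A : ℝ) (hφ : HalfPlaneDynamics.IsNormalForm φ A) :
    ((1 < A ∨ (A = 1 ∧ HalfPlaneDynamics.NonZeroStep φ)) →
      ∀ z₀ : ℍ, ∃ g α : ℍ → ℍ,
        HalfPlaneDynamics.IsRenormalizationPair φ z₀ g α ∧
        (g, α) ∈ HalfPlaneDynamics.forwardSolutions φ ∧
        ∀ σ τ : ℍ → ℍ, (σ, τ) ∈ HalfPlaneDynamics.forwardSolutions φ →
          ∀ z w : ℍ, dist (σ z) (σ w) ≤ dist (g z) (g w)) ∧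
    ((A = 1 ∧ HalfPlaneDynamics.ZeroStep φ) →
      HalfPlaneDynamics.forwardSolutions φ = ∅) := by
  refine ⟨fun h z₀ => ?_, fun ⟨_, h⟩ => ?_⟩
  · obtain ⟨g, α, hp, hm, hd⟩ := HalfPlaneDynamics.exists_isRenormalizationPair hφ.analytic
      (fun z => (hφ.im_lt z).le) (hφ.orbitDist_pos h z₀).ne'
    exact ⟨g, α, hp, hm, fun σ τ hστ z w =>
      (HalfPlaneDynamics.dist_forwardSolution_le hφ.analytic hστ z w).trans_eq (hd z w).symm⟩
  · refine Set.eq_empty_of_forall_notMem fun ⟨σ, τ⟩ hστ => ?_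
    obtain ⟨z, w, hzw⟩ := hστ.2.1
    refine hzw (dist_le_zero.1 ?_)
    rw [← HalfPlaneDynamics.orbitDist_eq_zero hφ.analytic hφ.ne_self h z w]
    exact HalfPlaneDynamics.dist_forwardSolution_le hφ.analytic hστ z w
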